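/- Let $\mathcal L=\{<_1,<_2\}$ consist of two binary relation symbols, and let $T_0$ be the $\mathcal L$-theory of an infinite set equipped with two dense linear orders $<_1$ and $<_2$. Then $T_0$ has a model completion, and any model completion $T$ of $T_0$ is complete and has quantifier elimination. Moreover, let $M$ be a model of $T$ and let $A\subseteq M$ be any subset. A (partial) $n$-type over $A$ is a finitely satisfiable set of formulas in $n$ variables with parameters from $A$; it is algebraic if it has only finitely many realizations in every elementary extension of $M$. For a cardinal $\mu$, a type $p$ over $A$ has dp-rank $\le\mu$ if for every realization $a$ of $p$ and any $1+\mu$ mutually $A$-indiscernible infinite sequences (all taken in a monster model, or equivalently in arbitrary elementary extensions of $M$), at least one of the sequences is indiscernible over $A\cup a$; it has dp-rank $\mu$ if it has dp-rank $\le\mu$ but not dp-rank $\le\lambda$ for any $\lambda<\mu$; it is dp-minimal if it has dp-rank $1$. Then: 1. every non-algebraic $1$-type over $A$ has dp-rank exactly $2$; 2. for every $n<\omega$, every $n$-type over $A$ has finite dp-rank; 3. for every $n<\omega$, no $n$-type over $A$ is dp-minimal. So $T$ is a theory of finite dp-rank with no dp-minimal types. -/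

import Mathlib

open FirstOrder FirstOrder.Language

universe u v w

/-- The relation symbols `<₁` and `<₂` (as `lt 0` and `lt 1`), both binary. -/
inductive TwoOrdersRel : ℕ → Type
  | lt (i : Fin 2) : TwoOrdersRel 2

/-- The language `{<₁, <₂}`, without function or constant symbols. -/
def twoOrdersLanguage : FirstOrder.Language.{0, 0} := ⟨fun _ => Empty, TwoOrdersRel⟩

/-- The symbol `<₁` for `i = 0` and `<₂` for `i = 1`. -/
def ltSymb (i : Fin 2) : twoOrdersLanguage.Relations 2 := TwoOrdersRel.lt i

/-- `∀ x y, x < y ∨ x = y ∨ y < x`. -/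
def trichotomySentence (i : Fin 2) : twoOrdersLanguage.Sentence :=
  ∀' ∀' ((ltSymb i).boundedFormula₂ (&0) (&1) ⊔
    (Term.bdEqual (&0) (&1) ⊔ (ltSymb i).boundedFormula₂ (&1) (&0)))

/-- `∀ x y, x < y → ∃ z, x < z ∧ z < y`. -/
def densitySentence (i : Fin 2) : twoOrdersLanguage.Sentence :=
  ∀' ∀' ((ltSymb i).boundedFormula₂ (&0) (&1) ⟹
    ∃' ((ltSymb i).boundedFormula₂ (&0) (&2) ⊓ (ltSymb i).boundedFormula₂ (&2) (&1)))

/-- The theory of an infinite set with two dense linear (strict) orders. -/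
def twoDenseOrdersTheory : twoOrdersLanguage.Theory :=
  twoOrdersLanguage.infiniteTheory ∪
    ⋃ i : Fin 2, {(ltSymb i).irreflexive, (ltSymb i).transitive,
      trichotomySentence i, densitySentence i}

section ModelCompletion

variable {L : FirstOrder.Language.{u, v}}

/-- Every formula is equivalent modulo `T` to a quantifier-free formula
in the same variables. -/
def HasQuantifierElimination (T : L.Theory) : Prop :=
  ∀ (n : ℕ) (φ : L.Formula (Fin n)), ∃ ψ : L.Formula (Fin n),
    BoundedFormula.IsQF ψ ∧ T.Iff φ ψ

/-- `T'` is a model completion of `T`: it is a model companion of `T` (models of either theory embed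
in models of the other one, and `T'` is model complete), and for every model `M` of `T` the theory
`T'` together with the quantifier-free diagram of `M` is complete, that is, any two models of `T'`
extending `M` satisfy the same formulas with parameters from `M`.
Models are nonempty and range over the universe that Mathlib uses for semantic consequence. -/
structure IsModelCompletion (T T' : L.Theory) : Prop where
  embeds : ∀ M : Theory.ModelType.{u, v, max u v} T,
    ∃ N : Theory.ModelType.{u, v, max u v} T', Nonempty (M ↪[L] N)
  embeds_back : ∀ M : Theory.ModelType.{u, v, max u v} T',
    ∃ N : Theory.ModelType.{u, v, max u v} T, Nonempty (M ↪[L] N)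
  modelComplete : ∀ (M N : Theory.ModelType.{u, v, max u v} T') (f : M ↪[L] N)
    (n : ℕ) (φ : L.Formula (Fin n)) (x : Fin n → M), φ.Realize (f ∘ x) ↔ φ.Realize x
  diagram_complete : ∀ (M : Theory.ModelType.{u, v, max u v} T)
    (N₁ N₂ : Theory.ModelType.{u, v, max u v} T') (f₁ : M ↪[L] N₁) (f₂ : M ↪[L] N₂)
    (n : ℕ) (φ : L.Formula (Fin n)) (x : Fin n → M),
    φ.Realize (f₁ ∘ x) ↔ φ.Realize (f₂ ∘ x)

end ModelCompletion

section DpRank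

/-- The sequence `I` of `m`-tuples is indiscernible over `B`: any two increasing finite subsequences
of the same length satisfy the same formulas with parameters from `B`.
A formula with parameters from `B` is a formula with additional free variables indexed by `B`,
which are assigned their own values. -/
def IsIndiscernibleOver (L : FirstOrder.Language.{0, 0}) {M : Type w} [L.Structure M] (B : Set M)
    {m : ℕ} (I : ℕ → Fin m → M) : Prop :=
  ∀ (k : ℕ) (i j : Fin k ↪o ℕ) (φ : L.Formula (B ⊕ (Fin k × Fin m))),
    φ.Realize (Sum.elim (fun b : B => (b : M)) (fun t => I (i t.1) t.2)) ↔
      φ.Realize (Sum.elim (fun b : B => (b : M)) (fun t => I (j t.1) t.2))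

/-- The sequences `I j` (of finite tuples, whose length may depend on `j`) are mutually
indiscernible over `A`: each is indiscernible over `A` and the entries of all the others. -/
def AreMutuallyIndiscernibleOver (L : FirstOrder.Language.{0, 0}) {M : Type w} [L.Structure M] (A : Set M)
    {J : Type*} {len : J → ℕ} (I : (j : J) → ℕ → Fin (len j) → M) : Prop :=
  ∀ j : J, IsIndiscernibleOver L
    (A ∪ {x | ∃ j' : J, j' ≠ j ∧ ∃ (i : ℕ) (t : Fin (len j')), x = I j' i t}) (I j)

variable {L : FirstOrder.Language.{0, 0}} {M : Type w} [L.Structure M] {A : Set M} {n : ℕ}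

/-- A set `p` of formulas over `A` in `n` variables is a (consistent, partial) `n`-type over `A`,
if it is finitely satisfiable in the model `M`. Complete types are the maximal such sets. -/
def IsTypeOver (p : Set (L.Formula (A ⊕ Fin n))) : Prop :=
  ∀ s : Finset (L.Formula (A ⊕ Fin n)), (s : Set (L.Formula (A ⊕ Fin n))) ⊆ p →
    ∃ a : Fin n → M, ∀ φ ∈ s, φ.Realize (Sum.elim (fun b : A => (b : M)) a)

/-- The tuple `a` of the elementary extension `f : M ↪ₑ[L] N` realizes `p`. -/
def Realizes {N : Type*} [L.Structure N] (f : M ↪ₑ[L] N)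
    (p : Set (L.Formula (A ⊕ Fin n))) (a : Fin n → N) : Prop :=
  ∀ φ ∈ p, φ.Realize (Sum.elim (fun b : A => f (b : M)) a)

/-- `p` has only finitely many realizations, in whatever elementary extension of `M`. -/
def IsAlgebraicType (p : Set (L.Formula (A ⊕ Fin n))) : Prop :=
  ∀ (N : Type w) [L.Structure N] (f : M ↪ₑ[L] N),
    {a : Fin n → N | Realizes f p a}.Finite

/-- The dp-rank of the type `p` over `A` is at most `μ`: for every realization `a` of `p` and any
`1 + μ` mutually `A`-indiscernible sequences, at least one of the sequences is indiscernible over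
`A ∪ a`. Realizations and sequences are taken in all elementary extensions of `M`; this amounts
to taking them in a monster model that extends `M`. -/
def DpRankLE (p : Set (L.Formula (A ⊕ Fin n))) (μ : Cardinal.{w}) : Prop :=
  ∀ (N : Type w) [L.Structure N] (f : M ↪ₑ[L] N) (a : Fin n → N), Realizes f p a →
    ∀ (J : Type w) (len : J → ℕ) (I : (j : J) → ℕ → Fin (len j) → N),
      Cardinal.mk J = 1 + μ → AreMutuallyIndiscernibleOver L (f '' A) I →
        ∃ j : J, IsIndiscernibleOver L (f '' A ∪ Set.range a) (I j)

/-- The dp-rank of `p` is `μ`. -/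
def DpRankEq (p : Set (L.Formula (A ⊕ Fin n))) (μ : Cardinal.{w}) : Prop :=
  DpRankLE p μ ∧ ∀ ν < μ, ¬ DpRankLE p ν

/-- `p` is dp-minimal: its dp-rank is `1`. -/
def IsDpMinimal (p : Set (L.Formula (A ⊕ Fin n))) : Prop :=
  DpRankEq p 1

end DpRank

/-! The model companion is the theory of two linear orders without endpoints in which every interval
of one order meets every interval of the other. A finite partial isomorphism into such a generic
structure extends by any further point, so by back-and-forth (`IsGeneric.realize_iff`) the truth of
a formula depends only on the order relations between its variables. Quantifier elimination,
completeness and model completeness follow. Finite pairs of linear orders embed into the generic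
model `RatPlane`, and an ultraproduct then embeds arbitrary ones. Every model of any model
completion is generic, so the rank can be computed in generic structures.

Upper bound: a tuple destroys the indiscernibility of a sequence only if some coordinate cuts it in
one of the two orders. An element cuts at most one of several mutually indiscernible sequences in a
given order (`IsBiordered.not_cuts_of_cuts`), so an `n`-tuple spoils at most `2 * n` sequences.

Lower bound: around a realization `c` outside `A`, two mutually indiscernible sequences can be
inserted infinitely close to `c`, one cut by `c` in each order (`not_dpRankLE_one`). Thus a type
with a coordinate outside `A` in some realization has rank at least `2`. If there is no such
coordinate, the rank is `0`, and hence rank `1` never occurs. -/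

/-- The interpretation of the symbol `<ᵢ` in an `ℒ`-structure. -/
def Below {M : Type*} [twoOrdersLanguage.Structure M] (i : Fin 2) (x y : M) : Prop :=
  Structure.RelMap (ltSymb i) ![x, y]

/-- Both symbols are interpreted by strict linear orders. -/
structure IsBiordered (M : Type*) [twoOrdersLanguage.Structure M] : Prop where
  irrefl : ∀ (i : Fin 2) (x : M), ¬ Below i x x
  trans : ∀ (i : Fin 2) (x y z : M), Below i x y → Below i y z → Below i x z
  trichotomy : ∀ (i : Fin 2) (x y : M), Below i x y ∨ x = y ∨ Below i y x

/-- Two linear orders without endpoints, such that every interval of the first one meets every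
interval of the second one. -/
structure IsGeneric (M : Type*) [twoOrdersLanguage.Structure M] : Prop extends IsBiordered M where
  exists_above : ∀ (i : Fin 2) (x : M), ∃ y, Below i x y
  exists_below : ∀ (i : Fin 2) (x : M), ∃ y, Below i y x
  exists_between : ∀ a b c d : M, Below 0 a b → Below 1 c d →
    ∃ z, (Below 0 a z ∧ Below 0 z b) ∧ (Below 1 c z ∧ Below 1 z d)

/-! ### Generic structures and back-and-forth -/

section Semantics

variable {M : Type*} [twoOrdersLanguage.Structure M] {N : Type*} [twoOrdersLanguage.Structure N]

theorem IsBiordered.asymm (h : IsBiordered M) {i : Fin 2} {x y : M} (hxy : Below i x y) :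
    ¬ Below i y x := fun hyx => h.irrefl i x (h.trans i x y x hxy hyx)

theorem IsBiordered.not_below_iff (h : IsBiordered M) {i : Fin 2} {x y : M} :
    ¬ Below i x y ↔ x = y ∨ Below i y x := by
  constructor
  · intro hn
    exact (h.trichotomy i x y).resolve_left hn
  · rintro (rfl | hyx)
    · exact h.irrefl i x
    · exact h.asymm hyx

theorem IsBiordered.eq_iff (h : IsBiordered M) (i : Fin 2) {x y : M} :
    x = y ↔ ¬ Below i x y ∧ ¬ Below i y x := by
  constructor
  · rintro rfl
    exact ⟨h.irrefl i x, h.irrefl i x⟩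
  · rintro ⟨h₁, h₂⟩
    exact (h.not_below_iff.1 h₁).resolve_right h₂

open Classical in
/-- The linear order given by the symbol `<ᵢ`. -/
noncomputable abbrev IsBiordered.linearOrder (h : IsBiordered M) (i : Fin 2) : LinearOrder M where
  le x y := x = y ∨ Below i x y
  lt x y := Below i x y
  le_refl x := Or.inl rfl
  le_trans := by
    rintro x y z (rfl | hxy) (rfl | hyz)
    · exact Or.inl rfl
    · exact Or.inr hyz
    · exact Or.inr hxy
    · exact Or.inr (h.trans i x y z hxy hyz)
  le_antisymm := by
    rintro x y (rfl | hxy) (hyx | hyx)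
    · rfl
    · rfl
    · exact hyx.symm
    · exact absurd hyx (h.asymm hxy)
  lt_iff_le_not_ge := by
    intro x y
    constructor
    · intro hxy
      refine ⟨Or.inr hxy, ?_⟩
      rintro (rfl | hyx)
      · exact h.irrefl i _ hxy
      · exact h.asymm hxy hyx
    · rintro ⟨rfl | hxy, hn⟩
      · exact absurd (Or.inl rfl) hn
      · exact hxy
  le_total x y := by
    rcases h.trichotomy i x y with hxy | hxy | hxy
    · exact Or.inl (Or.inr hxy)
    · exact Or.inl (Or.inl hxy)
    · exact Or.inr (Or.inr hxy)
  toDecidableLE := Classical.decRel _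

theorem IsGeneric.dense (h : IsGeneric M) (i : Fin 2) {a b : M} (hab : Below i a b) :
    ∃ z, Below i a z ∧ Below i z b := by
  fin_cases i
  · obtain ⟨d, hd⟩ := h.exists_above 1 a
    obtain ⟨z, hz, -⟩ := h.exists_between a b a d hab hd
    exact ⟨z, hz⟩
  · obtain ⟨d, hd⟩ := h.exists_above 0 a
    obtain ⟨z, -, hz⟩ := h.exists_between a d a b hd hab
    exact ⟨z, hz⟩

/-- Between two finite sets there is a whole interval. -/
theorem IsGeneric.exists_interval (h : IsGeneric N) [Nonempty N] (i : Fin 2) {lo hi : Set N}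
    (hlo : lo.Finite) (hhi : hi.Finite) (hlt : ∀ x ∈ lo, ∀ y ∈ hi, Below i x y) :
    ∃ a b : N, Below i a b ∧ (∀ x ∈ lo, Below i x a) ∧ ∀ y ∈ hi, Below i b y := by
  let _ : LinearOrder N := h.linearOrder i
  have : DenselyOrdered N := ⟨fun _ _ hab => h.dense i hab⟩
  have : NoMaxOrder N := ⟨fun x => h.exists_above i x⟩
  have : NoMinOrder N := ⟨fun x => h.exists_below i x⟩
  obtain ⟨a, ha₁, ha₂⟩ := Order.exists_between_finsets hlo.toFinset hhi.toFinset
    (fun x hx y hy => hlt x (by simpa using hx) y (by simpa using hy))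
  obtain ⟨b, hb₁, hb₂⟩ := Order.exists_between_finsets {a} hhi.toFinset
    (fun x hx y hy => by
      obtain rfl := Finset.mem_singleton.1 hx
      exact ha₂ y hy)
  exact ⟨a, b, hb₁ a (by simp), fun x hx => ha₁ x (by simpa using hx),
    fun y hy => hb₂ y (by simpa using hy)⟩

/-- One-point extensions of finite partial isomorphisms into a generic structure. -/
theorem IsGeneric.exists_extension (hN : IsGeneric N) [Nonempty N] (hM : IsBiordered M)
    {ι : Type*} [Finite ι] {v : ι → M} {v' : ι → N}
    (hv : ∀ i a b, Below i (v a) (v b) ↔ Below i (v' a) (v' b)) (m : M) :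
    ∃ z : N, ∀ i a, (Below i (v a) m ↔ Below i (v' a) z) ∧ (Below i m (v a) ↔ Below i z (v' a)) := by
  by_cases hm : ∃ a, v a = m
  · obtain ⟨a, rfl⟩ := hm
    exact ⟨v' a, fun i b => ⟨hv i b a, hv i a b⟩⟩
  push Not at hm
  have key : ∀ i : Fin 2, ∃ a b : N, Below i a b ∧
      (∀ x ∈ v' '' {a | Below i (v a) m}, Below i x a) ∧
      ∀ y ∈ v' '' {a | Below i m (v a)}, Below i b y := by
    intro i
    refine hN.exists_interval i (Set.toFinite _) (Set.toFinite _) ?_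
    rintro _ ⟨a, ha, rfl⟩ _ ⟨b, hb, rfl⟩
    exact (hv i a b).1 (hM.trans i _ _ _ ha hb)
  choose l r hlr hl hr using key
  obtain ⟨z, h0, h1⟩ := hN.exists_between (l 0) (r 0) (l 1) (r 1) (hlr 0) (hlr 1)
  have hz : ∀ i : Fin 2, Below i (l i) z ∧ Below i z (r i) := by
    intro i
    fin_cases i
    · exact h0
    · exact h1
  refine ⟨z, fun i a => ?_⟩
  rcases hM.trichotomy i (v a) m with h | h | h
  · have h' : Below i (v' a) z := hN.trans i _ _ _ (hl i _ ⟨a, h, rfl⟩) (hz i).1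
    exact ⟨iff_of_true h h', iff_of_false (hM.asymm h) (hN.asymm h')⟩
  · exact absurd h (hm a)
  · have h' : Below i z (v' a) := hN.trans i _ _ _ (hz i).2 (hr i _ ⟨a, h, rfl⟩)
    exact ⟨iff_of_false (hM.asymm h) (hN.asymm h'), iff_of_true h h'⟩

theorem twoOrdersLanguage.term_eq_var {α : Type*} (t : twoOrdersLanguage.Term α) :
    ∃ a, t = Term.var a := by
  cases t with
  | var a => exact ⟨a, rfl⟩
  | func f _ => exact f.elim

theorem twoOrdersLanguage.rel_eq {n : ℕ} (R : twoOrdersLanguage.Relations n) :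
    ∃ h : n = 2, ∃ i, h ▸ R = ltSymb i := by
  cases R with
  | lt i => exact ⟨rfl, i, rfl⟩

theorem relMap_ltSymb (i : Fin 2) (x : Fin 2 → M) :
    Structure.RelMap (ltSymb i) x ↔ Below i (x 0) (x 1) := by
  have : x = ![x 0, x 1] := by
    ext j
    fin_cases j <;> rfl
  rw [Below, ← this]

/-- Back-and-forth by induction on the formula: genericity enters only at the quantifier, where a
point chosen on either side is matched by `IsGeneric.exists_extension`. This is why only finitely
many variables are allowed. -/
theorem IsGeneric.boundedFormula_realize_iff (hM : IsGeneric M) (hN : IsGeneric N)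
    {α : Type*} [Finite α] {n : ℕ} (φ : twoOrdersLanguage.BoundedFormula α n)
    (v : α → M) (v' : α → N) (x : Fin n → M) (x' : Fin n → N) [Nonempty M] [Nonempty N]
    (h : ∀ i a b, Below i (Sum.elim v x a) (Sum.elim v x b) ↔
      Below i (Sum.elim v' x' a) (Sum.elim v' x' b)) :
    φ.Realize v x ↔ φ.Realize v' x' := by
  induction φ with
  | falsum => rfl
  | equal t₁ t₂ =>
    obtain ⟨a, rfl⟩ := twoOrdersLanguage.term_eq_var t₁
    obtain ⟨b, rfl⟩ := twoOrdersLanguage.term_eq_var t₂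
    simp only [BoundedFormula.Realize, Term.realize_var]
    rw [hM.eq_iff 0, hN.eq_iff 0, h, h]
  | rel R ts =>
    obtain ⟨rfl, i, rfl⟩ := twoOrdersLanguage.rel_eq R
    obtain ⟨a, ha⟩ := twoOrdersLanguage.term_eq_var (ts 0)
    obtain ⟨b, hb⟩ := twoOrdersLanguage.term_eq_var (ts 1)
    simp only [BoundedFormula.Realize]
    rw [relMap_ltSymb, relMap_ltSymb]
    simp only [ha, hb, Term.realize_var, h]
  | imp _ _ ih₁ ih₂ =>
    simp only [BoundedFormula.realize_imp]
    rw [ih₁ x x' h, ih₂ x x' h]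
  | @all k φ ih =>
    simp only [BoundedFormula.realize_all]
    have step : ∀ (m : M) (z : N), (∀ i a,
        (Below i (Sum.elim v x a) m ↔ Below i (Sum.elim v' x' a) z) ∧
        (Below i m (Sum.elim v x a) ↔ Below i z (Sum.elim v' x' a))) →
        (φ.Realize v (Fin.snoc x m) ↔ φ.Realize v' (Fin.snoc x' z)) := by
      intro m z hz
      apply ih
      intro i a b
      -- Each variable has either a previous value on both sides, or the new values `m` and `z`.
      have hc : ∀ c : α ⊕ Fin (k + 1),
          (∃ d, Sum.elim v (Fin.snoc x m : Fin (k + 1) → M) c = Sum.elim v x d ∧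
            Sum.elim v' (Fin.snoc x' z : Fin (k + 1) → N) c = Sum.elim v' x' d) ∨
          (Sum.elim v (Fin.snoc x m : Fin (k + 1) → M) c = m ∧
            Sum.elim v' (Fin.snoc x' z : Fin (k + 1) → N) c = z) := by
        rintro (c | c)
        · exact Or.inl ⟨Sum.inl c, rfl, rfl⟩
        · induction c using Fin.lastCases with
          | last => exact Or.inr ⟨by simp, by simp⟩
          | cast c => exact Or.inl ⟨Sum.inr c, by simp, by simp⟩
      rcases hc a with ⟨a', h₁, h₂⟩ | ⟨h₁, h₂⟩ <;> rcases hc b with ⟨b', h₃, h₄⟩ | ⟨h₃, h₄⟩ <;>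
        rw [h₁, h₂, h₃, h₄]
      · exact h i a' b'
      · exact (hz i a').1
      · exact (hz i b').2
      · exact iff_of_false (hM.irrefl i m) (hN.irrefl i z)
    constructor
    · intro hm z
      obtain ⟨m, hz⟩ := hM.exists_extension hN.toIsBiordered (fun i a b => (h i a b).symm) z
      exact (step m z fun i a => ⟨(hz i a).1.symm, (hz i a).2.symm⟩).1 (hm m)
    · intro hm m
      obtain ⟨z, hz⟩ := hN.exists_extension hM.toIsBiordered h m
      exact (step m z hz).2 (hm z)

/-- In generic structures, the truth of a formula only depends on the order relations between the
values of the variables. -/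
theorem IsGeneric.realize_iff (hM : IsGeneric M) (hN : IsGeneric N) [Nonempty M] [Nonempty N]
    {α : Type*} (φ : twoOrdersLanguage.Formula α) (v : α → M) (v' : α → N)
    (h : ∀ i a b, Below i (v a) (v b) ↔ Below i (v' a) (v' b)) :
    φ.Realize v ↔ φ.Realize v' := by
  classical
  -- Only finitely many variables occur in `φ`; restricting to them makes the finite case
  -- applicable.
  rw [Formula.Realize, Formula.Realize,
    ← BoundedFormula.realize_restrictFreeVar (f := id) (v := fun a => v a) v fun _ => rfl,
    ← BoundedFormula.realize_restrictFreeVar (f := id) (v := fun a => v' a) v' fun _ => rfl]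
  refine hM.boundedFormula_realize_iff hN _ _ _ _ _ ?_
  rintro i (a | a) (b | b)
  · exact h i a b
  · exact b.elim0
  · exact a.elim0
  · exact a.elim0

/-- Embeddings between generic structures are elementary. -/
def IsGeneric.elementaryEmbedding (hM : IsGeneric M) (hN : IsGeneric N) [Nonempty M] [Nonempty N]
    (f : M → N) (hf : ∀ i x y, Below i x y ↔ Below i (f x) (f y)) : M ↪ₑ[twoOrdersLanguage] N where
  toFun := f
  map_formula' _ φ x := (hM.realize_iff hN φ x (f ∘ x) fun i a b => hf i (x a) (x b)).symm

end Semantics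

/-! ### A countable generic model -/

section Model

/-- A set with two binary relations. -/
abbrev twoOrdersStructure {M : Type*} (r : Fin 2 → M → M → Prop) :
    twoOrdersLanguage.Structure M where
  funMap := fun f => f.elim
  RelMap := fun R => match R with
    | TwoOrdersRel.lt i => fun x => r i (x 0) (x 1)

/-- The plane `ℚ²`, ordered by `x + √2 y` and by `x - √2 y`. -/
def RatPlane : Type := ℚ × ℚ

noncomputable def RatPlane.coord (i : Fin 2) (p : ℝ × ℝ) : ℝ :=
  if i = 0 then p.1 + √2 * p.2 else p.1 - √2 * p.2

def RatPlane.toReal (p : RatPlane) : ℝ × ℝ := (p.1, p.2)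

noncomputable instance : twoOrdersLanguage.Structure RatPlane :=
  twoOrdersStructure fun i p q => RatPlane.coord i p.toReal < RatPlane.coord i q.toReal

instance : Infinite RatPlane := inferInstanceAs (Infinite (ℚ × ℚ))

theorem RatPlane.below_iff (i : Fin 2) (p q : RatPlane) :
    Below i p q ↔ coord i p.toReal < coord i q.toReal := Iff.rfl

theorem RatPlane.coord_injective (i : Fin 2) {p q : RatPlane}
    (h : coord i p.toReal = coord i q.toReal) : p = q := by
  obtain ⟨p₁, p₂⟩ := p
  obtain ⟨q₁, q₂⟩ := q
  have key : ∀ a b : ℚ, (a : ℝ) + √2 * b = 0 → a = 0 ∧ b = 0 := by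
    intro a b hab
    by_cases hb : b = 0
    · subst hb
      simpa using hab
    · exfalso
      -- A nontrivial rational relation would give `√2 = -a / b`.
      refine irrational_sqrt_two.ne_rat (-a / b) ?_
      have : (b : ℝ) ≠ 0 := by exact_mod_cast hb
      push_cast
      field_simp
      linarith
  have : p₁ = q₁ ∧ p₂ = q₂ := by
    fin_cases i
    · obtain ⟨h₁, h₂⟩ := key (p₁ - q₁) (p₂ - q₂) (by
        simp [coord, toReal] at h
        push_cast
        linarith)
      exact ⟨sub_eq_zero.1 h₁, sub_eq_zero.1 h₂⟩
    · obtain ⟨h₁, h₂⟩ := key (p₁ - q₁) (q₂ - p₂) (by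
        simp [coord, toReal] at h
        push_cast
        linarith)
      exact ⟨sub_eq_zero.1 h₁, (sub_eq_zero.1 h₂).symm⟩
  rw [this.1, this.2]

theorem RatPlane.exists_mem_box {a b c d : ℝ} (hab : a < b) (hcd : c < d) :
    ∃ z : RatPlane, (a < coord 0 z.toReal ∧ coord 0 z.toReal < b) ∧
      (c < coord 1 z.toReal ∧ coord 1 z.toReal < d) := by
  have hd : DenseRange toReal := Rat.denseRange_cast.prodMap Rat.denseRange_cast
  obtain ⟨z, hz⟩ := hd.exists_mem_open
    (s := {p : ℝ × ℝ | (a < coord 0 p ∧ coord 0 p < b) ∧ (c < coord 1 p ∧ coord 1 p < d)}) (by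
      have h0 : Continuous (coord 0) := by unfold coord; simp; fun_prop
      have h1 : Continuous (coord 1) := by unfold coord; simp; fun_prop
      exact ((isOpen_lt continuous_const h0).inter (isOpen_lt h0 continuous_const)).inter
        ((isOpen_lt continuous_const h1).inter (isOpen_lt h1 continuous_const)))
    -- The box is nonempty in `ℝ²`: this is the preimage of its centre under the linear map `(coord
    -- 0, coord 1)`.
    ⟨(((a + b) / 2 + (c + d) / 2) / 2, ((a + b) / 2 - (c + d) / 2) / 2 / √2), by
      have h2 : √2 * (((a + b) / 2 - (c + d) / 2) / 2 / √2) = ((a + b) / 2 - (c + d) / 2) / 2 :=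
        mul_div_cancel₀ _ (by positivity)
      simp only [coord, Set.mem_ofPred_eq, if_true, one_ne_zero, if_false, h2]
      refine ⟨⟨?_, ?_⟩, ?_, ?_⟩ <;> linarith⟩
  exact ⟨z, hz⟩

theorem RatPlane.isGeneric : IsGeneric RatPlane where
  irrefl i x := lt_irrefl _
  trans i x y z := lt_trans
  trichotomy i x y := by
    rcases lt_trichotomy (coord i x.toReal) (coord i y.toReal) with h | h | h
    · exact Or.inl h
    · exact Or.inr (Or.inl (coord_injective i h))
    · exact Or.inr (Or.inr h)
  exists_above i x := by
    fin_cases i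
    · obtain ⟨z, hz, -⟩ := exists_mem_box (lt_add_one (coord 0 x.toReal)) zero_lt_one
      exact ⟨z, hz.1⟩
    · obtain ⟨z, -, hz⟩ := exists_mem_box zero_lt_one (lt_add_one (coord 1 x.toReal))
      exact ⟨z, hz.1⟩
  exists_below i x := by
    fin_cases i
    · obtain ⟨z, hz, -⟩ := exists_mem_box (sub_one_lt (coord 0 x.toReal)) zero_lt_one
      exact ⟨z, hz.2⟩
    · obtain ⟨z, -, hz⟩ := exists_mem_box zero_lt_one (sub_one_lt (coord 1 x.toReal))
      exact ⟨z, hz.2⟩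
  exists_between a b c d hab hcd := exists_mem_box hab hcd

instance : Nonempty RatPlane := ⟨((0, 0) : ℚ × ℚ)⟩

end Model

/-! ### Axioms of genericity -/

section GenericTheory

/-- The axioms of genericity, as formulas whose universal closure is meant: no last element, no
first element, and the intersection of two intervals. -/
def genericityFormula : Fin 2 ⊕ Fin 2 ⊕ Unit → twoOrdersLanguage.Formula (Fin 4)
  | Sum.inl i => ∃' ((ltSymb i).boundedFormula₂ (Term.var (Sum.inl 0)) (&0))
  | Sum.inr (Sum.inl i) => ∃' ((ltSymb i).boundedFormula₂ (&0) (Term.var (Sum.inl 0)))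
  | Sum.inr (Sum.inr _) =>
    (ltSymb 0).boundedFormula₂ (Term.var (Sum.inl 0)) (Term.var (Sum.inl 1)) ⟹
    ((ltSymb 1).boundedFormula₂ (Term.var (Sum.inl 2)) (Term.var (Sum.inl 3)) ⟹
      ∃' (((ltSymb 0).boundedFormula₂ (Term.var (Sum.inl 0)) (&0) ⊓
        (ltSymb 0).boundedFormula₂ (&0) (Term.var (Sum.inl 1))) ⊓
        ((ltSymb 1).boundedFormula₂ (Term.var (Sum.inl 2)) (&0) ⊓
        (ltSymb 1).boundedFormula₂ (&0) (Term.var (Sum.inl 3)))))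

/-- The theory of two dense linear orders without endpoints in generic position. -/
noncomputable def genericTheory : twoOrdersLanguage.Theory :=
  twoDenseOrdersTheory ∪
    Set.range fun k => ((genericityFormula k).relabel (Sum.inr : Fin 4 → Empty ⊕ Fin 4)).iAlls (Fin 4)

variable {M : Type*} [twoOrdersLanguage.Structure M] {N : Type*} [twoOrdersLanguage.Structure N]

theorem genericityFormula_above_realize (i : Fin 2) (x : Fin 4 → M) :
    (genericityFormula (Sum.inl i)).Realize x ↔ ∃ y, Below i (x 0) y := by
  simp [genericityFormula, Formula.Realize, Below, Fin.snoc]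

theorem genericityFormula_below_realize (i : Fin 2) (x : Fin 4 → M) :
    (genericityFormula (Sum.inr (Sum.inl i))).Realize x ↔ ∃ y, Below i y (x 0) := by
  simp [genericityFormula, Formula.Realize, Below, Fin.snoc]

theorem genericityFormula_between_realize (x : Fin 4 → M) :
    (genericityFormula (Sum.inr (Sum.inr ()))).Realize x ↔
      (Below 0 (x 0) (x 1) → Below 1 (x 2) (x 3) →
        ∃ z, (Below 0 (x 0) z ∧ Below 0 z (x 1)) ∧ (Below 1 (x 2) z ∧ Below 1 z (x 3))) := by
  simp [genericityFormula, Formula.Realize, Below, Fin.snoc]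

theorem forall_genericityFormula_realize_iff :
    (∀ k (x : Fin 4 → M), (genericityFormula k).Realize x) ↔
      (∀ (i : Fin 2) (x : M), ∃ y, Below i x y) ∧ (∀ (i : Fin 2) (x : M), ∃ y, Below i y x) ∧
      ∀ a b c d : M, Below 0 a b → Below 1 c d →
        ∃ z, (Below 0 a z ∧ Below 0 z b) ∧ (Below 1 c z ∧ Below 1 z d) := by
  constructor
  · intro h
    exact ⟨fun i x => (genericityFormula_above_realize i fun _ => x).1 (h _ _),
      fun i x => (genericityFormula_below_realize i fun _ => x).1 (h _ _),
      fun a b c d => (genericityFormula_between_realize ![a, b, c, d]).1 (h _ _)⟩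
  · rintro ⟨h₁, h₂, h₃⟩ (i | i | _) x
    · exact (genericityFormula_above_realize i x).2 (h₁ i _)
    · exact (genericityFormula_below_realize i x).2 (h₂ i _)
    · exact (genericityFormula_between_realize x).2 (h₃ _ _ _ _)

/-- The genericity axioms hold at the elements of a generic substructure. -/
theorem IsGeneric.genericityFormula_realize_comp (hM : IsGeneric M) (f : M → N)
    (hf : ∀ i x y, Below i x y ↔ Below i (f x) (f y)) (k : Fin 2 ⊕ Fin 2 ⊕ Unit)
    (x : Fin 4 → M) : (genericityFormula k).Realize (f ∘ x) := by
  rcases k with i | i | _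
  · obtain ⟨y, hy⟩ := hM.exists_above i (x 0)
    exact (genericityFormula_above_realize i _).2 ⟨f y, (hf i _ _).1 hy⟩
  · obtain ⟨y, hy⟩ := hM.exists_below i (x 0)
    exact (genericityFormula_below_realize i _).2 ⟨f y, (hf i _ _).1 hy⟩
  · refine (genericityFormula_between_realize _).2 fun hab hcd => ?_
    obtain ⟨z, ⟨h₁, h₂⟩, h₃, h₄⟩ := hM.exists_between _ _ _ _ ((hf _ _ _).2 hab) ((hf _ _ _).2 hcd)
    exact ⟨f z, ⟨(hf _ _ _).1 h₁, (hf _ _ _).1 h₂⟩, (hf _ _ _).1 h₃, (hf _ _ _).1 h₄⟩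

theorem model_twoDenseOrdersTheory_iff :
    M ⊨ twoDenseOrdersTheory ↔ Infinite M ∧ IsBiordered M ∧
      ∀ (i : Fin 2) (x y : M), Below i x y → ∃ z, Below i x z ∧ Below i z y := by
  have hirr : ∀ i : Fin 2, M ⊨ (ltSymb i).irreflexive ↔ ∀ x : M, ¬ Below i x x := fun i => by
    simp [Relations.irreflexive, Sentence.Realize, Formula.Realize, Below, Fin.snoc]
  have htrans : ∀ i : Fin 2, M ⊨ (ltSymb i).transitive ↔
      ∀ x y z : M, Below i x y → Below i y z → Below i x z := fun i => by
    simp [Relations.transitive, Sentence.Realize, Formula.Realize, Below, Fin.snoc]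
  have htri : ∀ i : Fin 2, M ⊨ trichotomySentence i ↔
      ∀ x y : M, Below i x y ∨ x = y ∨ Below i y x := fun i => by
    simp [trichotomySentence, Sentence.Realize, Formula.Realize, Below, Fin.snoc]
  have hdense : ∀ i : Fin 2, M ⊨ densitySentence i ↔
      ∀ x y : M, Below i x y → ∃ z, Below i x z ∧ Below i z y := fun i => by
    simp [densitySentence, Sentence.Realize, Formula.Realize, Below, Fin.snoc]
  have hsplit : M ⊨ twoDenseOrdersTheory ↔ Infinite M ∧ ∀ i : Fin 2,
      M ⊨ (ltSymb i).irreflexive ∧ M ⊨ (ltSymb i).transitive ∧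
        M ⊨ trichotomySentence i ∧ M ⊨ densitySentence i := by
    rw [twoDenseOrdersTheory, Theory.model_union_iff, model_infiniteTheory_iff]
    refine and_congr_right fun _ => ?_
    rw [Theory.model_iff]
    constructor
    · intro h i
      have hi : ∀ φ ∈ ({(ltSymb i).irreflexive, (ltSymb i).transitive, trichotomySentence i,
          densitySentence i} : twoOrdersLanguage.Theory), M ⊨ φ :=
        fun φ hφ => h φ (Set.mem_iUnion.2 ⟨i, hφ⟩)
      exact ⟨hi _ (by simp), hi _ (by simp), hi _ (by simp), hi _ (by simp)⟩
    · intro h φ hφ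
      obtain ⟨i, hi⟩ := Set.mem_iUnion.1 hφ
      obtain ⟨h₁, h₂, h₃, h₄⟩ := h i
      rcases hi with rfl | rfl | rfl | rfl <;> assumption
  simp only [hsplit, hirr, htrans, htri, hdense]
  constructor
  · rintro ⟨h, h'⟩
    exact ⟨h, ⟨fun i => (h' i).1, fun i => (h' i).2.1, fun i => (h' i).2.2.1⟩,
      fun i => (h' i).2.2.2⟩
  · rintro ⟨h, ⟨h₁, h₂, h₃⟩, h₄⟩
    exact ⟨h, fun i => ⟨h₁ i, h₂ i, h₃ i, h₄ i⟩⟩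

theorem model_genericTheory_iff : M ⊨ genericTheory ↔ Infinite M ∧ IsGeneric M := by
  have hgen : M ⊨ (Set.range fun k => ((genericityFormula k).relabel
      (Sum.inr : Fin 4 → Empty ⊕ Fin 4)).iAlls (Fin 4) : twoOrdersLanguage.Theory) ↔
      ∀ k (x : Fin 4 → M), (genericityFormula k).Realize x := by
    simp only [Theory.model_iff, Set.forall_mem_range, Sentence.Realize, Formula.realize_iAlls,
      Formula.realize_relabel, Sum.elim_comp_inr]
  rw [genericTheory, Theory.model_union_iff, hgen, forall_genericityFormula_realize_iff,
    model_twoDenseOrdersTheory_iff]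
  constructor
  · rintro ⟨⟨h, hb, -⟩, h₁, h₂, h₃⟩
    exact ⟨h, ⟨hb, h₁, h₂, h₃⟩⟩
  · rintro ⟨h, hg⟩
    exact ⟨⟨h, hg.toIsBiordered, fun i _ _ => hg.dense i⟩, hg.exists_above, hg.exists_below,
      hg.exists_between⟩

theorem IsGeneric.of_model [h : M ⊨ genericTheory] : IsGeneric M :=
  (model_genericTheory_iff.1 h).2

instance : RatPlane ⊨ genericTheory :=
  model_genericTheory_iff.2 ⟨inferInstance, RatPlane.isGeneric⟩

/-- Points are added one at a time with `IsGeneric.exists_extension`. -/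
theorem IsBiordered.exists_map_ratPlane (hM : IsBiordered M) (s : Finset M) :
    ∃ e : M → RatPlane, ∀ i, ∀ x ∈ s, ∀ y ∈ s, Below i x y ↔ Below i (e x) (e y) := by
  classical
  induction s using Finset.induction_on with
  | empty => exact ⟨fun _ => Classical.arbitrary _, by simp⟩
  | insert m s hm ih =>
    obtain ⟨e, he⟩ := ih
    obtain ⟨z, hz⟩ := RatPlane.isGeneric.exists_extension hM (v := fun x : s => (x : M))
      (v' := fun x : s => e x) (fun i a b => he i a a.2 b b.2) m
    have hne : ∀ x ∈ s, x ≠ m := by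
      rintro x hx rfl
      exact hm hx
    refine ⟨Function.update e m z, fun i x hx y hy => ?_⟩
    rcases Finset.mem_insert.1 hx with rfl | hx' <;> rcases Finset.mem_insert.1 hy with rfl | hy'
    · exact iff_of_false (hM.irrefl i _) (RatPlane.isGeneric.irrefl i _)
    · rw [Function.update_self, Function.update_of_ne (hne y hy')]
      exact (hz i ⟨y, hy'⟩).2
    · rw [Function.update_self, Function.update_of_ne (hne x hx')]
      exact (hz i ⟨x, hx'⟩).1
    · rw [Function.update_of_ne (hne x hx'), Function.update_of_ne (hne y hy')]
      exact he i x hx' y hy'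

end GenericTheory

/-! ### Embedding into generic structures; the model completion -/

/-- Every set with two linear orders embeds into a generic structure of the same universe. -/
theorem IsBiordered.exists_generic {M : Type w} [twoOrdersLanguage.Structure M]
    (hM : IsBiordered M) :
    ∃ (N : Type w) (_ : twoOrdersLanguage.Structure N) (_ : Nonempty N) (f : M → N),
      N ⊨ genericTheory ∧ ∀ i x y, Below i x y ↔ Below i (f x) (f y) := by
  classical
  -- An ultrafilter finer than `atTop`: any two given points lie in almost every finite set `s`, so
  -- the finite maps `e s` together preserve both orders.
  let u : Ultrafilter (Finset M) := Ultrafilter.of Filter.atTop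
  choose e he using hM.exists_map_ratPlane
  refine ⟨(u : Filter (Finset M)).Product fun _ => RatPlane, inferInstance, inferInstance,
    fun x => ((fun s => e s x : Finset M → RatPlane) :
      (u : Filter (Finset M)).Product fun _ => RatPlane), ?_, fun i x y => ?_⟩
  · rw [Theory.model_iff]
    intro φ hφ
    rw [Ultraproduct.sentence_realize]
    exact Filter.Eventually.of_forall fun _ => Theory.realize_sentence_of_mem genericTheory hφ
  · have hxy : ∀ᶠ s in (u : Filter (Finset M)), x ∈ s ∧ y ∈ s := by
      refine (Ultrafilter.of_le Filter.atTop) ?_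
      filter_upwards [Filter.eventually_ge_atTop {x, y}] with s hs
      exact ⟨hs (by simp), hs (by simp)⟩
    have hφ := Ultraproduct.realize_formula_cast (u := u) (M := fun _ => RatPlane)
      ((ltSymb i).formula₂ (Term.var 0) (Term.var 1) : twoOrdersLanguage.Formula (Fin 2))
      ![fun s => e s x, fun s => e s y]
    simp only [Formula.realize_rel₂, Term.realize_var] at hφ
    refine Iff.trans ?_ hφ.symm
    constructor
    · intro h
      filter_upwards [hxy] with s hs
      exact (he s i x hs.1 y hs.2).1 h
    · intro h
      obtain ⟨s, hs, hs'⟩ := (h.and hxy).exists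
      exact (he s i x hs'.1 y hs'.2).2 hs

theorem FirstOrder.Language.Embedding.below_iff {M N : Type*} [twoOrdersLanguage.Structure M]
    [twoOrdersLanguage.Structure N] (f : M ↪[twoOrdersLanguage] N) (i : Fin 2) (x y : M) :
    Below i x y ↔ Below i (f x) (f y) := by
  rw [Below, ← f.map_rel, Below]
  congr! 1
  ext j
  fin_cases j <;> rfl

/-- An order preserving map of two linear orders is an embedding of structures. -/
def IsBiordered.toEmbedding {M N : Type*} [twoOrdersLanguage.Structure M]
    [twoOrdersLanguage.Structure N] (hM : IsBiordered M) (hN : IsBiordered N) (f : M → N)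
    (hf : ∀ i x y, Below i x y ↔ Below i (f x) (f y)) : M ↪[twoOrdersLanguage] N where
  toFun := f
  inj' x y hxy := by
    rw [hM.eq_iff 0, hf, hf, ← hN.eq_iff]
    exact hxy
  map_fun' g := g.elim
  map_rel' R x := by
    obtain ⟨rfl, i, rfl⟩ := twoOrdersLanguage.rel_eq R
    rw [relMap_ltSymb, relMap_ltSymb, hf]
    rfl

theorem IsBiordered.of_embedding {M N : Type*} [twoOrdersLanguage.Structure M]
    [twoOrdersLanguage.Structure N] (hN : IsBiordered N) (f : M ↪[twoOrdersLanguage] N) :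
    IsBiordered M where
  irrefl i x hx := hN.irrefl i _ ((f.below_iff i x x).1 hx)
  trans i x y z hxy hyz :=
    (f.below_iff i x z).2 (hN.trans i _ _ _ ((f.below_iff i x y).1 hxy) ((f.below_iff i y z).1 hyz))
  trichotomy i x y := by
    rw [f.below_iff, f.below_iff, ← f.injective.eq_iff]
    exact hN.trichotomy i _ _

theorem isModelCompletion_genericTheory :
    IsModelCompletion twoDenseOrdersTheory genericTheory where
  embeds M := by
    have hM := (model_twoDenseOrdersTheory_iff.1 M.is_model).2.1
    obtain ⟨N, _, _, f, hN, hf⟩ := hM.exists_generic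
    exact ⟨Theory.ModelType.of genericTheory N,
      ⟨hM.toEmbedding (model_genericTheory_iff.1 hN).2.toIsBiordered f hf⟩⟩
  embeds_back M :=
    haveI : M ⊨ twoDenseOrdersTheory := M.is_model.mono Set.subset_union_left
    ⟨Theory.ModelType.of twoDenseOrdersTheory M, ⟨Embedding.refl _ _⟩⟩
  modelComplete M N f n φ x :=
    (IsGeneric.of_model.realize_iff IsGeneric.of_model φ x (f ∘ x)
      fun i a b => f.below_iff i (x a) (x b)).symm
  diagram_complete M N₁ N₂ f₁ f₂ n φ x :=
    IsGeneric.of_model.realize_iff IsGeneric.of_model φ (f₁ ∘ x) (f₂ ∘ x) fun i a b =>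
      (f₁.below_iff i (x a) (x b)).symm.trans (f₂.below_iff i (x a) (x b))

/-! ### Models of an arbitrary model completion -/

namespace IsModelCompletion

variable {T : twoOrdersLanguage.Theory}

/-- The model `M` sits inside a generic `N₁`, which sits inside a model `N₂` of `T`. Witnesses for
the genericity axioms exist in `N₁`, hence in `N₂`, and model completeness brings the axioms down to
`M`. -/
theorem isGeneric_modelType (hT : IsModelCompletion twoDenseOrdersTheory T)
    (M : Theory.ModelType.{0, 0, 0} T) : IsGeneric M := by
  obtain ⟨N₀, ⟨f₀⟩⟩ := hT.embeds_back M
  obtain ⟨N₁, ⟨f₁⟩⟩ := isModelCompletion_genericTheory.embeds N₀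
  obtain ⟨N₁', ⟨f₁'⟩⟩ := isModelCompletion_genericTheory.embeds_back N₁
  obtain ⟨N₂, ⟨f₂⟩⟩ := hT.embeds N₁'
  let g : N₁ ↪[twoOrdersLanguage] N₂ := f₂.comp f₁'
  let f : M ↪[twoOrdersLanguage] N₁ := f₁.comp f₀
  have hb : IsBiordered M :=
    (model_twoDenseOrdersTheory_iff.1 N₀.is_model).2.1.of_embedding f₀
  have hM : ∀ k (x : Fin 4 → M), (genericityFormula k).Realize x := fun k x =>
    (hT.modelComplete M N₂ (g.comp f) 4 _ x).1
      (IsGeneric.of_model.genericityFormula_realize_comp g g.below_iff k (f ∘ x))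
  obtain ⟨h₁, h₂, h₃⟩ := forall_genericityFormula_realize_iff.1 hM
  exact ⟨hb, h₁, h₂, h₃⟩

theorem models_genericTheory (hT : IsModelCompletion twoDenseOrdersTheory T)
    (M : Theory.ModelType.{0, 0, 0} T) : M ⊨ genericTheory := by
  have hM := hT.isGeneric_modelType M
  have : Infinite M := by
    let _ : LinearOrder M := hM.linearOrder 0
    have : NoMaxOrder M := ⟨fun x => hM.exists_above 0 x⟩
    exact NoMaxOrder.infinite
  exact model_genericTheory_iff.2 ⟨this, hM⟩

/-- Semantic consequence, tested in one universe, transfers the axioms to models in every universe.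
-/
theorem model_genericTheory (hT : IsModelCompletion twoDenseOrdersTheory T) {M : Type*}
    [twoOrdersLanguage.Structure M] [Nonempty M] (hM : M ⊨ T) : M ⊨ genericTheory := by
  rw [Theory.model_iff]
  intro φ hφ
  refine Theory.ModelsBoundedFormula.realize_sentence (T := T) ?_ M
  rw [Theory.models_sentence_iff]
  intro N
  have := hT.models_genericTheory N
  exact Theory.realize_sentence_of_mem genericTheory hφ

theorem isComplete (hT : IsModelCompletion twoDenseOrdersTheory T) : T.IsComplete := by
  have : RatPlane ⊨ twoDenseOrdersTheory :=
    Theory.Model.mono (T' := genericTheory) inferInstance Set.subset_union_left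
  obtain ⟨M, -⟩ := hT.embeds (Theory.ModelType.of twoDenseOrdersTheory RatPlane)
  refine ⟨⟨M⟩, fun φ => ?_⟩
  have hφ : ∀ N : Theory.ModelType.{0, 0, 0} T, N ⊨ φ ↔ M ⊨ φ := fun N =>
    (hT.isGeneric_modelType N).realize_iff (hT.isGeneric_modelType M) φ _ _ fun _ a => a.elim
  rw [Theory.models_sentence_iff, Theory.models_sentence_iff]
  by_cases hM : M ⊨ φ
  · exact Or.inl fun N => (hφ N).2 hM
  · exact Or.inr fun N => (Sentence.realize_not N).2 fun hN => hM ((hφ N).1 hN)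

end IsModelCompletion

/-! ### Quantifier elimination -/

section QuantifierElimination

theorem FirstOrder.Language.BoundedFormula.IsQF.iInf {L : FirstOrder.Language.{u, v}}
    {α β : Type*} {n : ℕ} [Finite β] {f : β → L.BoundedFormula α n} (hf : ∀ b, (f b).IsQF) :
    (BoundedFormula.iInf f).IsQF := by
  rw [BoundedFormula.iInf]
  generalize Finset.toList _ = l
  induction l with
  | nil => exact BoundedFormula.IsQF.top
  | cons b l ih => exact (hf b).inf ih

theorem FirstOrder.Language.BoundedFormula.IsQF.iSup {L : FirstOrder.Language.{u, v}}
    {α β : Type*} {n : ℕ} [Finite β] {f : β → L.BoundedFormula α n} (hf : ∀ b, (f b).IsQF) :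
    (BoundedFormula.iSup f).IsQF := by
  rw [BoundedFormula.iSup]
  generalize Finset.toList _ = l
  induction l with
  | nil => exact BoundedFormula.isQF_bot
  | cons b l ih => exact (hf b).sup ih

open Classical in
/-- The conjunction of the literals that describe the order relations `S` of `n` variables. -/
noncomputable def orderTypeFormula {n : ℕ} (S : Set (Fin 2 × Fin n × Fin n)) :
    twoOrdersLanguage.Formula (Fin n) :=
  Formula.iInf fun t : Fin 2 × Fin n × Fin n =>
    if t ∈ S then (ltSymb t.1).formula₂ (Term.var t.2.1) (Term.var t.2.2)
    else ((ltSymb t.1).formula₂ (Term.var t.2.1) (Term.var t.2.2)).not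

theorem isQF_orderTypeFormula {n : ℕ} (S : Set (Fin 2 × Fin n × Fin n)) :
    BoundedFormula.IsQF (orderTypeFormula S) := by
  refine BoundedFormula.IsQF.iInf fun t => ?_
  have ht : BoundedFormula.IsQF ((ltSymb t.1).formula₂ (Term.var t.2.1) (Term.var t.2.2) :
      twoOrdersLanguage.Formula (Fin n)) := (BoundedFormula.IsAtomic.rel _ _).isQF
  split_ifs
  · exact ht
  · exact ht.not

theorem orderTypeFormula_realize_iff {M : Type*} [twoOrdersLanguage.Structure M] {n : ℕ}
    (S : Set (Fin 2 × Fin n × Fin n)) (x : Fin n → M) :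
    (orderTypeFormula S).Realize x ↔ ∀ i a b, (i, a, b) ∈ S ↔ Below i (x a) (x b) := by
  rw [orderTypeFormula, Formula.realize_iInf]
  constructor
  · intro h i a b
    have := h (i, a, b)
    by_cases hS : (i, a, b) ∈ S
    · rw [if_pos hS, Formula.realize_rel₂] at this
      exact iff_of_true hS this
    · rw [if_neg hS, Formula.realize_not, Formula.realize_rel₂] at this
      exact iff_of_false hS this
  · rintro h ⟨i, a, b⟩
    by_cases hS : (i, a, b) ∈ S
    · rw [if_pos hS, Formula.realize_rel₂]
      exact (h i a b).1 hS
    · rw [if_neg hS, Formula.realize_not, Formula.realize_rel₂]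
      exact fun hx => hS ((h i a b).2 hx)

theorem IsModelCompletion.hasQuantifierElimination {T : twoOrdersLanguage.Theory}
    (hT : IsModelCompletion twoDenseOrdersTheory T) : HasQuantifierElimination T := by
  intro n φ
  -- The finitely many order types compatible with `φ` in some model of `T`. By
  -- `IsGeneric.realize_iff`, each of them already implies `φ`, so their disjunction is equivalent
  -- to `φ`.
  let good : Set (Set (Fin 2 × Fin n × Fin n)) := {S | ∃ (M : Theory.ModelType.{0, 0, 0} T)
    (x : Fin n → M), (orderTypeFormula S).Realize x ∧ φ.Realize x}
  refine ⟨Formula.iSup fun S : good => orderTypeFormula S,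
    BoundedFormula.IsQF.iSup fun S => isQF_orderTypeFormula S.1, ?_⟩
  refine Theory.models_formula_iff.2 fun M x => ?_
  refine Formula.realize_iff.2 ?_
  rw [Formula.realize_iSup]
  constructor
  · intro hx
    have hS : (orderTypeFormula {t | Below t.1 (x t.2.1) (x t.2.2)}).Realize x :=
      (orderTypeFormula_realize_iff _ x).2 fun _ _ _ => Iff.rfl
    exact ⟨⟨_, M, x, hS, hx⟩, hS⟩
  · rintro ⟨⟨S, N, y, hy, hφ⟩, hx⟩
    rw [orderTypeFormula_realize_iff] at hy hx
    exact ((hT.isGeneric_modelType M).realize_iff (hT.isGeneric_modelType N) φ x y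
      fun i a b => (hx i a b).symm.trans (hy i a b)).2 hφ

end QuantifierElimination

/-! ### Indiscernibility in generic structures -/

section Indiscernibility

theorem IsIndiscernibleOver.mono {L : FirstOrder.Language.{0, 0}} {M : Type*} [L.Structure M]
    {B C : Set M} {m : ℕ} {I : ℕ → Fin m → M} (h : IsIndiscernibleOver L C I) (hBC : B ⊆ C) :
    IsIndiscernibleOver L B I := by
  intro k i j φ
  have := h k i j (φ.relabel (Sum.map (Set.inclusion hBC) id))
  rw [Formula.realize_relabel, Formula.realize_relabel] at this
  convert! this using 2 <;> ext (a | a) <;> rfl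

theorem AreMutuallyIndiscernibleOver.comp {L : FirstOrder.Language.{0, 0}} {M : Type*}
    [L.Structure M] {A : Set M} {J J' : Type*} {len : J → ℕ} {I : (j : J) → ℕ → Fin (len j) → M}
    (h : AreMutuallyIndiscernibleOver L A I) {g : J' → J} (hg : Function.Injective g) :
    AreMutuallyIndiscernibleOver L A (fun j => I (g j)) := by
  intro j
  refine (h (g j)).mono (Set.union_subset_union_right _ ?_)
  rintro x ⟨j', hj', i, t, hx⟩
  exact ⟨g j', fun h => hj' (hg h), i, t, hx⟩

/-- Superfluous sequences can be discarded, since subfamilies remain mutually indiscernible. -/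
theorem DpRankLE.mono {L : FirstOrder.Language.{0, 0}} {M : Type w} [L.Structure M] {A : Set M}
    {n : ℕ} {p : Set (L.Formula (A ⊕ Fin n))} {ν μ : Cardinal.{w}} (h : DpRankLE p ν)
    (hνμ : ν ≤ μ) : DpRankLE p μ := by
  intro N _ f a ha J len I hJ hI
  have hle : Cardinal.mk (1 + ν).out ≤ Cardinal.mk J := by
    rw [Cardinal.mk_out, hJ]
    gcongr
  obtain ⟨g⟩ := Cardinal.le_def _ _ |>.1 hle
  obtain ⟨j, hj⟩ := h N f a ha _ _ _ (Cardinal.mk_out _) (hI.comp g.injective)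
  exact ⟨g j, hj⟩

variable {M : Type*} [twoOrdersLanguage.Structure M] [Nonempty M] {B : Set M}

/-- In a generic structure, indiscernibility is a condition on atomic formulas. -/
theorem IsGeneric.isIndiscernibleOver_iff (hM : IsGeneric M) {m : ℕ} {I : ℕ → Fin m → M} :
    IsIndiscernibleOver twoOrdersLanguage B I ↔
      ∀ (k : ℕ) (i j : Fin k ↪o ℕ) (r : Fin 2) (a b : B ⊕ (Fin k × Fin m)),
        Below r (Sum.elim (fun b : B => (b : M)) (fun t => I (i t.1) t.2) a)
          (Sum.elim (fun b : B => (b : M)) (fun t => I (i t.1) t.2) b) ↔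
        Below r (Sum.elim (fun b : B => (b : M)) (fun t => I (j t.1) t.2) a)
          (Sum.elim (fun b : B => (b : M)) (fun t => I (j t.1) t.2) b) := by
  constructor
  · intro h k i j r a b
    have := h k i j ((ltSymb r).formula₂ (Term.var a) (Term.var b))
    rwa [Formula.realize_rel₂, Formula.realize_rel₂] at this
  · intro h k i j φ
    exact hM.realize_iff hM φ _ _ (h k i j)

theorem IsGeneric.below_iff_of_isIndiscernibleOver (hM : IsGeneric M) {m : ℕ}
    {I : ℕ → Fin m → M} (hI : IsIndiscernibleOver twoOrdersLanguage B I) {c : M} (hc : c ∈ B)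
    (r : Fin 2) (t : Fin m) (k k' : ℕ) :
    (Below r (I k t) c ↔ Below r (I k' t) c) ∧ (Below r c (I k t) ↔ Below r c (I k' t)) := by
  -- Subsequences with the single term `k`.
  let e : ℕ → Fin 1 ↪o ℕ := fun k => OrderEmbedding.ofStrictMono (fun _ => k) fun x y hxy =>
    absurd hxy (by rw [Subsingleton.elim x y]; exact lt_irrefl _)
  have h := hM.isIndiscernibleOver_iff.1 hI 1 (e k) (e k') r
  exact ⟨h (Sum.inr (0, t)) (Sum.inl ⟨c, hc⟩), h (Sum.inl ⟨c, hc⟩) (Sum.inr (0, t))⟩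

/-- Atomic formulas have two variables, so a new parameter meets at most one term of the sequence at
a time. -/
theorem IsGeneric.isIndiscernibleOver_union (hM : IsGeneric M) {m : ℕ} {I : ℕ → Fin m → M}
    (hI : IsIndiscernibleOver twoOrdersLanguage B I) {C : Set M}
    (hC : ∀ c ∈ C, ∀ (r : Fin 2) (t : Fin m) (k k' : ℕ),
      (Below r (I k t) c ↔ Below r (I k' t) c) ∧ (Below r c (I k t) ↔ Below r c (I k' t))) :
    IsIndiscernibleOver twoOrdersLanguage (B ∪ C) I := by
  have hBC : ∀ c ∈ B ∪ C, ∀ (r : Fin 2) (t : Fin m) (k k' : ℕ),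
      (Below r (I k t) c ↔ Below r (I k' t) c) ∧ (Below r c (I k t) ↔ Below r c (I k' t)) := by
    rintro c (hc | hc)
    · exact hM.below_iff_of_isIndiscernibleOver hI hc
    · exact hC c hc
  rw [hM.isIndiscernibleOver_iff]
  rintro k i j r (a | a) (b | b)
  · exact Iff.rfl
  · exact (hBC a a.2 r b.2 _ _).2
  · exact (hBC b b.2 r a.2 _ _).1
  · exact hM.isIndiscernibleOver_iff.1 hI k i j r (Sum.inr a) (Sum.inr b)

theorem IsGeneric.isIndiscernibleOver_of_monotone (hM : IsGeneric M) {x : ℕ → M}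
    (hx : ∀ r : Fin 2, (∀ i j, Below r (x i) (x j) ↔ i < j) ∨ ∀ i j, Below r (x i) (x j) ↔ j < i)
    (hB : ∀ b ∈ B, ∀ (r : Fin 2) (k k' : ℕ),
      (Below r (x k) b ↔ Below r (x k') b) ∧ (Below r b (x k) ↔ Below r b (x k'))) :
    IsIndiscernibleOver twoOrdersLanguage B (fun i (_ : Fin 1) => x i) := by
  rw [hM.isIndiscernibleOver_iff]
  rintro k i j r (a | a) (b | b)
  · exact Iff.rfl
  · exact (hB a a.2 r _ _).2
  · exact (hB b b.2 r _ _).1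
  · rcases hx r with h | h
    · exact (h _ _).trans (Iff.trans (by rw [i.lt_iff_lt, j.lt_iff_lt]) (h _ _).symm)
    · exact (h _ _).trans (Iff.trans (by rw [i.lt_iff_lt, j.lt_iff_lt]) (h _ _).symm)

end Indiscernibility

/-! ### Upper bound for the dp-rank -/

section UpperBound

variable {M : Type*} [twoOrdersLanguage.Structure M]

/-- The element `c` lies between two distinct terms of the sequence `x`, in the weak sense. -/
def Cuts (r : Fin 2) (x : ℕ → M) (c : M) : Prop :=
  ∃ k k', ¬ Below r c (x k) ∧ ¬ Below r (x k') c ∧ x k ≠ x k'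

theorem IsBiordered.cuts_of_not_constant (hM : IsBiordered M) {r : Fin 2} {x : ℕ → M} {c : M}
    (h : ¬ ∀ k k', (Below r (x k) c ↔ Below r (x k') c) ∧ (Below r c (x k) ↔ Below r c (x k'))) :
    Cuts r x c := by
  contrapose! h
  have h₁ : ∀ k k', Below r (x k) c → Below r (x k') c := by
    intro k k' hk
    by_contra hk'
    exact h ⟨k, k', hM.asymm hk, hk', fun he => hk' (he ▸ hk)⟩
  have h₂ : ∀ k k', Below r c (x k) → Below r c (x k') := by
    intro k k' hk
    by_contra hk'
    exact h ⟨k', k, hk', hM.asymm hk, fun he => hk' (he ▸ hk)⟩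
  exact fun k k' => ⟨⟨h₁ k k', h₁ k' k⟩, ⟨h₂ k k', h₂ k' k⟩⟩

/-- One element does not cut two mutually indiscernible sequences with respect to one order. -/
theorem IsBiordered.not_cuts_of_cuts (hM : IsBiordered M) {r : Fin 2} {x y : ℕ → M} {c : M}
    (hxy : ∀ m k k', (Below r (x k) (y m) ↔ Below r (x k') (y m)) ∧
      (Below r (y m) (x k) ↔ Below r (y m) (x k')))
    (hyx : ∀ k m m', Below r (y m) (x k) ↔ Below r (y m') (x k))
    (hx : Cuts r x c) : ¬ Cuts r y c := by
  rintro ⟨m, m', hm, hm', -⟩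
  obtain ⟨k, k', hk, hk', hne⟩ := hx
  -- With `v ≤ c ≤ u`, the relation `u < v` is impossible.
  have key : ∀ {u v : M}, Below r u v → ¬ Below r c v → ¬ Below r u c → False := by
    intro u v huv hv hu
    rcases hM.not_below_iff.1 hv with rfl | hv
    · exact hu huv
    · exact hu (hM.trans r _ _ _ huv hv)
  rcases hM.trichotomy r (x k) (y m) with h | h | h
  · exact key ((hxy m k k').1.1 h) hm hk'
  -- A common term would equal all terms of `x`, contradicting the two distinct terms in `Cuts`.
  · refine hne (h.trans ?_)
    rw [eq_comm, hM.eq_iff r, ← (hxy m k k').1, ← (hxy m k k').2]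
    exact (hM.eq_iff r).1 h
  · exact key ((hyx k m m').1 h) hk hm'

/-- Pigeonhole: each spoiled sequence is charged to a coordinate of `a` and an order that cut it,
and no such pair is charged twice. There are `2 * n` pairs but `1 + 2 * n` sequences. -/
theorem dpRankLE_two_mul {M : Type w} [twoOrdersLanguage.Structure M] [Nonempty M]
    [M ⊨ genericTheory] {A : Set M} {n : ℕ} (p : Set (twoOrdersLanguage.Formula (A ⊕ Fin n))) :
    DpRankLE p ((2 * n : ℕ) : Cardinal.{w}) := by
  intro N _ f a _ J len I hJ hI
  have : Nonempty N := ⟨f (Classical.arbitrary M)⟩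
  have : N ⊨ genericTheory := (f.theory_model_iff genericTheory).1 inferInstance
  have hN : IsGeneric N := IsGeneric.of_model
  by_contra! hbad
  have hcut : ∀ j, ∃ (l : Fin n × Fin 2) (t : Fin (len j)), Cuts l.2 (fun k => I j k t) (a l.1) := by
    intro j
    by_contra! hj
    refine hbad j (hN.isIndiscernibleOver_union ((hI j).mono Set.subset_union_left) ?_)
    rintro _ ⟨l, rfl⟩ r t
    by_contra h
    exact hj (l, r) t (hN.cuts_of_not_constant h)
  choose l t hl using hcut
  have hinj : Function.Injective l := by
    intro j j' hjj'
    by_contra hne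
    have hmem : ∀ {j j'}, j ≠ j' → ∀ k, I j' k (t j') ∈ f '' A ∪
        {x | ∃ j'' : J, j'' ≠ j ∧ ∃ (i : ℕ) (t : Fin (len j'')), x = I j'' i t} :=
      fun hne k => Or.inr ⟨_, Ne.symm hne, k, _, rfl⟩
    refine hN.not_cuts_of_cuts (fun m k k' => ?_) (fun k m m' => ?_) (hl j) (hjj' ▸ hl j')
    · exact hN.below_iff_of_isIndiscernibleOver (hI j) (hmem hne m) _ _ k k'
    · exact (hN.below_iff_of_isIndiscernibleOver (hI j') (hmem (Ne.symm hne) k) _ _ m m').1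
  have hcard := Nat.card_le_card_of_injective l hinj
  have hJ' : Nat.card J = 1 + 2 * n := by
    rw [Nat.card, hJ, ← Nat.cast_one, ← Nat.cast_add, Cardinal.toNat_natCast]
  simp [hJ'] at hcard
  omega

end UpperBound

/-! ### Lower bound: inserting sequences next to an element -/

section LowerBound

/-- The structure `N` with two sequences inserted in the immediate neighbourhood of `c`. In the
order `<ᵣ`, the sequence with index `r` is increasing, and `c` lies between its first two terms;
the other sequence is decreasing and lies to the left of `c` and of the first one. -/
def Insertion {N : Type*} (_c : N) : Type _ := N ⊕ (Fin 2 × ℕ)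

namespace Insertion

variable {N : Type*} {c : N}

/-- The element of `N` near which an element is located. -/
def base : Insertion c → N
  | Sum.inl y => y
  | Sum.inr _ => c

/-- The position of an element relative to its base. -/
def offset (r : Fin 2) : Insertion c → ℤ
  | Sum.inl _ => 0
  | Sum.inr (s, i) => if s = r then (if i = 0 then -1 else i) else -2 - i

def old (c y : N) : Insertion c := Sum.inl y

def new (c : N) (s : Fin 2) (i : ℕ) : Insertion c := Sum.inr (s, i)

/-- In the order `r`, the offsets at `c` are `0` for `c`, then `-1, 1, 2, …` for sequence `r` and
`-2, -3, …` for the other one, without repetition. So ordering by base and then by offset is linear.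
-/
theorem eq_of_offset (r : Fin 2) {x y : Insertion c} (hb : x.base = y.base)
    (ho : x.offset r = y.offset r) : x = y := by
  rcases x with x | ⟨s, i⟩ <;> rcases y with y | ⟨s', i'⟩ <;> simp only [base, offset] at hb ho
  · rw [hb]
  · split_ifs at ho <;> omega
  · split_ifs at ho <;> omega
  · have : s = s' ∧ i = i' := by split_ifs at ho <;> omega
    rw [this.1, this.2]

instance [twoOrdersLanguage.Structure N] : twoOrdersLanguage.Structure (Insertion c) :=
  twoOrdersStructure fun r x y =>
    Below r x.base y.base ∨ x.base = y.base ∧ x.offset r < y.offset r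

variable [twoOrdersLanguage.Structure N]

theorem below_iff (r : Fin 2) (x y : Insertion c) :
    Below r x y ↔ Below r x.base y.base ∨ x.base = y.base ∧ x.offset r < y.offset r := Iff.rfl

theorem isBiordered (hN : IsBiordered N) : IsBiordered (Insertion c) where
  irrefl r x h := by
    rcases h with h | h
    · exact hN.irrefl r _ h
    · exact lt_irrefl _ h.2
  trans r x y z hxy hyz := by
    rw [below_iff] at *
    rcases hxy with hxy | ⟨hxy, hxy'⟩ <;> rcases hyz with hyz | ⟨hyz, hyz'⟩
    · exact Or.inl (hN.trans r _ _ _ hxy hyz)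
    · exact Or.inl (hyz ▸ hxy)
    · exact Or.inl (hxy ▸ hyz)
    · exact Or.inr ⟨hxy.trans hyz, hxy'.trans hyz'⟩
  trichotomy r x y := by
    rw [below_iff, below_iff]
    rcases hN.trichotomy r x.base y.base with h | h | h
    · exact Or.inl (Or.inl h)
    · rcases lt_trichotomy (x.offset r) (y.offset r) with h' | h' | h'
      · exact Or.inl (Or.inr ⟨h, h'⟩)
      · exact Or.inr (Or.inl (eq_of_offset r h h'))
      · exact Or.inr (Or.inr (Or.inr ⟨h.symm, h'⟩))
    · exact Or.inr (Or.inr (Or.inl h))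

theorem below_old_old (r : Fin 2) (x y : N) :
    Below r (old c x) (old c y) ↔ Below r x y := by
  rw [below_iff]
  simp [old, base, offset]

/-- Old points other than `c` cannot distinguish the new points from `c`; hence the new sequences
are indiscernible over parameters that avoid `c`. -/
theorem below_old_new (r : Fin 2) {y : N} (hy : y ≠ c) (s : Fin 2) (i : ℕ) :
    Below r (old c y) (new c s i) ↔ Below r y c := by
  rw [below_iff]
  simp [old, new, base, hy]

theorem below_new_old (r : Fin 2) {y : N} (hy : y ≠ c) (s : Fin 2) (i : ℕ) :
    Below r (new c s i) (old c y) ↔ Below r c y := by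
  rw [below_iff]
  simp [old, new, base, hy.symm]

theorem below_new_self (hN : IsBiordered N) (r : Fin 2) (i : ℕ) :
    Below r (new c r i) (old c c) ↔ i = 0 := by
  rw [below_iff]
  simp [old, new, base, offset, hN.irrefl]
  split_ifs <;> omega

theorem below_new_new (hN : IsBiordered N) (r s s' : Fin 2) (i i' : ℕ) :
    Below r (new c s i) (new c s' i') ↔
      if s = s' then (if s = r then i < i' else i' < i) else s ≠ r := by
  rw [below_iff]
  simp [new, base, offset, hN.irrefl]
  split_ifs <;> omega

end Insertion

/-- Both sequences are inserted around `c = a l`, and the result is embedded into a generic `K`, an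
elementary extension of `N`. As `c` is not in `A`, the sequences are mutually indiscernible over
`A`, but sequence `s` is cut by `c` in the order `s`. -/
theorem not_dpRankLE_one {M : Type w} [twoOrdersLanguage.Structure M] [Nonempty M]
    [M ⊨ genericTheory] {A : Set M} {n : ℕ} {p : Set (twoOrdersLanguage.Formula (A ⊕ Fin n))}
    {N : Type w} [twoOrdersLanguage.Structure N] (f : M ↪ₑ[twoOrdersLanguage] N) {a : Fin n → N}
    (ha : Realizes f p a) {l : Fin n} (hl : a l ∉ f '' A) : ¬ DpRankLE p 1 := by
  intro hp
  have : Nonempty N := ⟨a l⟩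
  have : N ⊨ genericTheory := (f.theory_model_iff genericTheory).1 inferInstance
  have hN : IsGeneric N := IsGeneric.of_model
  let c := a l
  obtain ⟨K, _, _, e, _, he⟩ := (Insertion.isBiordered (c := c) hN.toIsBiordered).exists_generic
  have hK : IsGeneric K := IsGeneric.of_model
  let g : N ↪ₑ[twoOrdersLanguage] K := hN.elementaryEmbedding hK (fun y => e (Insertion.old c y))
    fun i x y => by rw [← he, Insertion.below_old_old]
  have hg : ∀ y, g y = e (Insertion.old c y) := fun _ => rfl
  have hreal : Realizes (g.comp f) p (g ∘ a) := by
    intro φ hφ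
    have h := (g.map_formula φ _).2 (ha φ hφ)
    convert! h using 1
    ext (b | t) <;> rfl
  let I : ULift.{w} (Fin 2) → ℕ → Fin 1 → K := fun s i _ => e (Insertion.new c s.down i)
  have hI : AreMutuallyIndiscernibleOver twoOrdersLanguage ((g.comp f) '' A) I := by
    rintro ⟨s⟩
    refine hK.isIndiscernibleOver_of_monotone (fun r => ?_) ?_
    · by_cases hr : s = r
      · left
        intro i j
        rw [← he, Insertion.below_new_new hN.toIsBiordered, if_pos rfl, if_pos hr]
      · right
        intro i j
        rw [← he, Insertion.below_new_new hN.toIsBiordered, if_pos rfl, if_neg hr]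
    · rintro _ (⟨y, hy, rfl⟩ | ⟨⟨s'⟩, hs', i, -, rfl⟩) r k k'
      · have hne : f y ≠ c := fun h => hl ⟨y, hy, h⟩
        rw [ElementaryEmbedding.comp_apply, hg, ← he, ← he, ← he, ← he,
          Insertion.below_new_old r hne, Insertion.below_new_old r hne,
          Insertion.below_old_new r hne, Insertion.below_old_new r hne]
        exact ⟨Iff.rfl, Iff.rfl⟩
      · have hne : s' ≠ s := fun h => hs' (h ▸ rfl)
        simp only [I]
        rw [← he, ← he, ← he, ← he, Insertion.below_new_new hN.toIsBiordered,
          Insertion.below_new_new hN.toIsBiordered, Insertion.below_new_new hN.toIsBiordered,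
          Insertion.below_new_new hN.toIsBiordered, if_neg hne, if_neg hne, if_neg hne.symm,
          if_neg hne.symm]
        exact ⟨Iff.rfl, Iff.rfl⟩
  obtain ⟨⟨s⟩, hs⟩ := hp K (g.comp f) (g ∘ a) hreal (ULift.{w} (Fin 2)) _ I
    (by simp; norm_num) hI
  -- Terms `0` and `1` of sequence `s` lie on opposite sides of `c` in the order `s`.
  have h01 := (hK.below_iff_of_isIndiscernibleOver hs (c := g c) (Or.inr ⟨l, rfl⟩) s 0 0 1).1
  simp only [I] at h01
  rw [hg, ← he, ← he, Insertion.below_new_self hN.toIsBiordered,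
    Insertion.below_new_self hN.toIsBiordered] at h01
  omega

end LowerBound

/-! ### Realizations outside the parameter set -/

section Realizations

/-- A non-algebraic type in one variable over `A` has a realization outside `A`. -/
theorem exists_realizes_notMem {L : FirstOrder.Language.{0, 0}} {M : Type w} [L.Structure M]
    [Nonempty M] {A : Set M} {p : Set (L.Formula (A ⊕ Fin 1))} (hp : ¬ IsAlgebraicType p) :
    ∃ (N : Type w) (_ : L.Structure N) (f : M ↪ₑ[L] N) (a : Fin 1 → N),
      Realizes f p a ∧ a 0 ∉ f '' A := by
  simp only [IsAlgebraicType, not_forall] at hp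
  obtain ⟨N, _, f, hinf⟩ := hp
  have : Nonempty N := ⟨f (Classical.arbitrary M)⟩
  -- Infinitely many distinct realizations define one realization in an ultrapower of `N`. It
  -- differs from every constant sequence, so it lies outside the image of `N`.
  let s := Set.Infinite.natEmbedding _ hinf
  let u : Ultrafilter ℕ := Filter.hyperfilter ℕ
  let K := (u : Filter ℕ).Product fun _ => N
  let mk : (ℕ → N) → K := fun x => (x : (u : Filter ℕ).Product fun _ => N)
  let g : N ↪ₑ[L] K :=
    { toFun := fun y => mk fun _ => y
      map_formula' := fun n φ x => by
        refine (Ultraproduct.realize_formula_cast φ fun i _ => x i).trans ?_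
        simp }
  refine ⟨K, inferInstance, g.comp f, fun t => mk fun k => (s k : Fin 1 → N) t, ?_, ?_⟩
  · intro φ hφ
    have h := (Ultraproduct.realize_formula_cast (u := u) (M := fun _ => N) φ
      (Sum.elim (fun b _ => f b) (fun t k => (s k : Fin 1 → N) t))).2
      (Filter.Eventually.of_forall fun k => by
        convert! (s k).2 φ hφ using 1
        ext (b | t) <;> rfl)
    convert! h using 1
    ext (b | t) <;> rfl
  · rintro ⟨b, -, hb⟩
    have hb' : ∀ᶠ k in (u : Filter ℕ), f b = (s k : Fin 1 → N) 0 := Quotient.exact hb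
    refine Filter.notMem_hyperfilter_of_finite (s := {k | f b = (s k : Fin 1 → N) 0}) ?_ hb'
    refine Set.Subsingleton.finite fun k hk k' hk' => s.injective (Subtype.ext (funext fun t => ?_))
    rw [Subsingleton.elim t 0]
    exact hk.symm.trans hk'

/-- The least natural bound is the rank, because cardinals below a natural number are natural
numbers. -/
theorem exists_dpRankEq_of_dpRankLE {L : FirstOrder.Language.{0, 0}} {M : Type w} [L.Structure M]
    {A : Set M} {n : ℕ} {p : Set (L.Formula (A ⊕ Fin n))} {m : ℕ} (h : DpRankLE p (m : Cardinal.{w})) :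
    ∃ k : ℕ, DpRankEq p k := by
  classical
  have hex : ∃ k : ℕ, DpRankLE p (k : Cardinal.{w}) := ⟨m, h⟩
  refine ⟨Nat.find hex, Nat.find_spec hex, fun ν hν hle => ?_⟩
  obtain ⟨k, rfl⟩ := Cardinal.lt_aleph0.1 (hν.trans (Cardinal.natCast_lt_aleph0))
  exact Nat.find_min hex (by exact_mod_cast hν) hle

/-- A type that has not dp-rank `0` is realized by a tuple which is not contained in `A`. -/
theorem exists_realizes_notMem_of_not_dpRankLE_zero {L : FirstOrder.Language.{0, 0}} {M : Type w}
    [L.Structure M] {A : Set M} {n : ℕ} {p : Set (L.Formula (A ⊕ Fin n))} (h : ¬ DpRankLE p 0) :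
    ∃ (N : Type w) (_ : L.Structure N) (f : M ↪ₑ[L] N) (a : Fin n → N) (l : Fin n),
      Realizes f p a ∧ a l ∉ f '' A := by
  by_contra! hA
  refine h fun N _ f a ha J len I hJ hI => ?_
  have hne : Nonempty J := by
    rw [← Cardinal.mk_ne_zero_iff, hJ]
    simp
  refine ⟨hne.some, (hI hne.some).mono (Set.union_subset Set.subset_union_left ?_)⟩
  rintro _ ⟨l, rfl⟩
  exact Or.inl (hA N _ f a l ha)

end Realizations

/-! ### The main theorem -/

theorem mainTheorem11 :
    (∃ T : twoOrdersLanguage.Theory, IsModelCompletion twoDenseOrdersTheory T) ∧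
    ∀ T : twoOrdersLanguage.Theory, IsModelCompletion twoDenseOrdersTheory T →
      T.IsComplete ∧ HasQuantifierElimination T ∧
      ∀ (M : Type w) [twoOrdersLanguage.Structure M] [Nonempty M], M ⊨ T → ∀ A : Set M,
        -- every non-algebraic 1-type over `A` has dp-rank exactly 2
        (∀ p : Set (twoOrdersLanguage.Formula (A ⊕ Fin 1)),
          IsTypeOver p → ¬ IsAlgebraicType p → DpRankEq p 2) ∧
        -- every type over `A` in finitely many variables has finite dp-rank
        (∀ (n : ℕ) (p : Set (twoOrdersLanguage.Formula (A ⊕ Fin n))),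
          IsTypeOver p → ∃ k : ℕ, DpRankEq p k) ∧
        -- no type over `A` in finitely many variables is dp-minimal
        (∀ (n : ℕ) (p : Set (twoOrdersLanguage.Formula (A ⊕ Fin n))),
          IsTypeOver p → ¬ IsDpMinimal p) := by
  refine ⟨⟨genericTheory, isModelCompletion_genericTheory⟩, fun T hT =>
    ⟨hT.isComplete, hT.hasQuantifierElimination, fun M _ _ hM A => ?_⟩⟩
  have := hT.model_genericTheory hM
  refine ⟨fun p _ hp => ⟨?_, fun ν hν hle => ?_⟩,
    fun n p _ => exists_dpRankEq_of_dpRankLE (dpRankLE_two_mul p), fun n p _ hp => ?_⟩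
  · simpa using dpRankLE_two_mul p
  · obtain ⟨N, _, f, a, ha, hA⟩ := exists_realizes_notMem hp
    refine not_dpRankLE_one f ha hA (hle.mono ?_)
    obtain ⟨k, rfl⟩ := Cardinal.lt_aleph0.1 (hν.trans Cardinal.ofNat_lt_aleph0)
    have hk : k < 2 := by exact_mod_cast hν
    exact_mod_cast Nat.le_of_lt_succ hk
  -- Rank `1` excludes rank `0`, so some realization leaves `A`; this in turn excludes rank at most
  -- `1`.
  · obtain ⟨N, _, f, a, l, ha, hA⟩ :=
      exists_realizes_notMem_of_not_dpRankLE_zero (hp.2 0 zero_lt_one)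
    exact not_dpRankLE_one f ha hA hp.1
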